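/- Let $k\ge 1$ be an integer and let $\Lambda^{(k)}=\mathbb Q[h_1,\dots,h_k]$ be the subring of the ring of symmetric functions in infinitely many variables $x_1,x_2,\dots$ that is generated over $\mathbb Q$ by the complete symmetric functions $h_1,\dots,h_k$. For a partition $\lambda$ with $n$ parts let $s_\lambda=\det\bigl(h_{\lambda_i+j-i}\bigr)_{1\le i,j\le n}$ be its Schur function, where $h_0=1$ and $h_r=0$ for $r<0$, and let $h_M(\lambda)=\lambda_1+n-1$ be its main hook-length. A partition is $k$-bounded if all of its parts are at most $k$. The $k$-split $\lambda^{\to k}=(\lambda^{(1)},\dots,\lambda^{(r)})$ of a $k$-bounded partition $\lambda$ is obtained by cutting $\lambda$, without rearranging its entries, into partitions with $h_M(\lambda^{(i)})=k$ for $i<r$ and $h_M(\lambda^{(r)})\le k$; put $G^{(k)}_\lambda=s_{\lambda^{(1)}}\cdots s_{\lambda^{(r)}}$ (with $G^{(k)}_{()}=1$). The $G^{(k)}_\lambda$, for $\lambda$ $k$-bounded, form a basis of $\Lambda^{(k)}$, and $T^{(k)}_j$ is the linear operator on $\Lambda^{(k)}$ with $T^{(k)}_jG^{(k)}_\lambda=G^{(k)}_\lambda$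 if $\lambda_1=j$ and $T^{(k)}_jG^{(k)}_\lambda=0$ otherwise. The $k$-Schur functions are defined recursively by $s^{(k)}_{()}=1$ and $$s^{(k)}_\lambda=T^{(k)}_{\lambda_1}\bigl(s_{\lambda_1}\,s^{(k)}_{(\lambda_2,\lambda_3,\dots)}\bigr).$$ A $k$-bounded partition is irreducible if it has at most $i$ parts equal to $k-i$ for each $i=0,\dots,k-1$. Let $\mathcal I_k$ be the ideal of $\Lambda^{(k)}$ generated by the Schur functions $s_{(\ell^{k+1-\ell})}$, $\ell=1,\dots,k$, where $(\ell^{k+1-\ell})$ is the partition with $k+1-\ell$ parts equal to $\ell$. **Theorem.** The classes of the $k$-Schur functions $s^{(k)}_\lambda$, indexed by the irreducible $k$-bounded partitions $\lambda$, form a basis of the quotient ring $\Lambda^{(k)}/\mathcal I_k$ as a vector space over $\mathbb Q$, and this quotient has dimension $k!$. -/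

import Mathlib

/-! Symmetric functions are modelled as formal power series over `ℚ` in the countably many
variables `x_0, x_1, x_2, …`. Partitions are weakly decreasing lists of positive integers. -/

noncomputable section

namespace KSchur

/-- The complete symmetric function `h_r`: the sum of all monomials of degree `r` in infinitely
many variables. The index is an integer, and `h_r = 0` for `r < 0`. -/
def h (r : ℤ) : MvPowerSeries ℕ ℚ :=
  fun m => if (m.degree : ℤ) = r then 1 else 0

/-- The Schur function `s_λ = det (h_{λ_i + j - i})` of a partition `λ` (Jacobi-Trudi). -/
def schur (l : List ℕ) : MvPowerSeries ℕ ℚ :=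
  Matrix.det (Matrix.of fun i j : Fin l.length => h ((l.get i : ℤ) + (j : ℤ) - (i : ℤ)))

/-- The ring `Λ^(k) = ℚ[h_1, …, h_k]`, a subring of the ring of symmetric functions. -/
def ringK (k : ℕ) : Subalgebra ℚ (MvPowerSeries ℕ ℚ) :=
  Algebra.adjoin ℚ (h '' Set.Icc 1 (k : ℤ))

/-- The main hook-length `λ_1 + ℓ(λ) - 1` (it is `0` for the empty partition). -/
def mainHook (l : List ℕ) : ℕ := l.headD 0 + l.length - 1

/-- The `k`-bounded partitions: weakly decreasing lists of positive integers that are at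
most `k`. -/
def BoundedPartition (k : ℕ) : Type :=
  {l : List ℕ // l.Pairwise (· ≥ ·) ∧ ∀ x ∈ l, 0 < x ∧ x ≤ k}

/-- The first part `λ_1`, which is `0` for the empty partition. -/
def BoundedPartition.first {k : ℕ} (p : BoundedPartition k) : ℕ := p.1.headD 0

/-- A `k`-bounded partition is irreducible if it has at most `i` parts equal to `k - i`, for
`i = 0, …, k - 1`. -/
def BoundedPartition.Irreducible {k : ℕ} (p : BoundedPartition k) : Prop :=
  ∀ i < k, p.1.count (k - i) ≤ i

/-- The `k`-split of a `k`-bounded partition: it is cut, without rearranging its entries, into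
pieces of main hook-length `k`, except that the last piece may have a smaller main hook-length.
A piece with first part `a` and main hook-length `k` has `k - a + 1` entries. -/
def kSplit (k : ℕ) : List ℕ → List (List ℕ)
  | [] => []
  | a :: l => (a :: l.take (k - a)) :: kSplit k (l.drop (k - a))
termination_by l => l.length
decreasing_by simp

theorem h_mem {k : ℕ} {r : ℤ} (hr : r ≤ k) : h r ∈ ringK k := by
  rcases lt_trichotomy r 0 with h0 | h0 | h0
  · have : h r = 0 := by
      funext m
      have : (m.degree : ℤ) ≠ r := by omega
      simp only [h, if_neg this]
      rfl
    rw [this]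
    exact zero_mem _
  · have : h r = 1 := by
      ext m
      rw [MvPowerSeries.coeff_one]
      change (if (m.degree : ℤ) = r then (1 : ℚ) else 0) = _
      simp [h0, Finsupp.degree_eq_zero_iff]
    rw [this]
    exact one_mem _
  · exact Algebra.subset_adjoin ⟨r, ⟨by omega, hr⟩, rfl⟩

theorem get_le_headD {l : List ℕ} (hl : l.Pairwise (· ≥ ·)) (i : Fin l.length) :
    l.get i ≤ l.headD 0 := by
  cases l with
  | nil => exact i.elim0
  | cons a t =>
    have hm : (a :: t).get i ∈ a :: t := List.get_mem _ _
    rcases List.mem_cons.1 hm with e | hm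
    · exact e.le
    · simpa using List.rel_of_pairwise_cons hl hm

theorem schur_mem {k : ℕ} {l : List ℕ} (hl : l.Pairwise (· ≥ ·)) (hk : mainHook l ≤ k) :
    schur l ∈ ringK k := by
  unfold schur
  rw [Matrix.det_apply]
  refine sum_mem fun σ _ => ?_
  rw [Units.smul_def]
  refine zsmul_mem (prod_mem fun i _ => ?_) _
  rw [Matrix.of_apply]
  apply h_mem
  have h1 := get_le_headD hl (σ i)
  have h2 := i.2
  unfold mainHook at hk
  omega

theorem kSplit_spec (k : ℕ) (l : List ℕ) (hl : l.Pairwise (· ≥ ·)) (hb : ∀ x ∈ l, x ≤ k) :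
    ∀ q ∈ kSplit k l, q.Pairwise (· ≥ ·) ∧ mainHook q ≤ k := by
  fun_induction kSplit k l with
  | case1 => simp
  | case2 a l ih =>
    intro q hq
    rw [List.mem_cons] at hq
    rw [List.pairwise_cons] at hl
    rcases hq with rfl | hq
    · refine ⟨List.pairwise_cons.2 ⟨fun x hx => hl.1 x (List.mem_of_mem_take hx),
        hl.2.sublist (List.take_sublist _ _)⟩, ?_⟩
      have := hb a (by simp)
      simp only [mainHook, List.headD_cons, List.length_cons, List.length_take]
      omega
    · exact ih (hl.2.sublist (List.drop_sublist _ _))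
        (fun x hx => hb x (List.mem_cons_of_mem _ (List.mem_of_mem_drop hx))) q hq

/-- The Schur function of a partition with main hook-length at most `k`, as an element of
`Λ^(k)`. -/
def schurK (k : ℕ) (l : List ℕ) (hl : l.Pairwise (· ≥ ·)) (hk : mainHook l ≤ k) : ringK k :=
  ⟨schur l, schur_mem hl hk⟩

/-- The `k`-split polynomial `G_λ^(k)`, the product of the Schur functions of the pieces of the
`k`-split of `λ`. -/
def splitPoly (k : ℕ) (p : BoundedPartition k) : ringK k :=
  ⟨((kSplit k p.1).map schur).prod, by
    refine list_prod_mem fun x hx => ?_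
    obtain ⟨q, hq, rfl⟩ := List.mem_map.1 hx
    have := kSplit_spec k p.1 p.2.1 (fun x hx => (p.2.2 x hx).2) q hq
    exact schur_mem this.1 this.2⟩

open Classical in
/-- The projection operator `T_j^(k)`, the linear operator on `Λ^(k)` that fixes `G_λ^(k)` if
`λ_1 = j` and sends it to `0` otherwise. The `k`-split polynomials are a basis of `Λ^(k)`, so that
the value in the case `else` is never taken. -/
def proj (k j : ℕ) : ringK k →ₗ[ℚ] ringK k :=
  if hb : LinearIndependent ℚ (splitPoly k) ∧ ⊤ ≤ Submodule.span ℚ (Set.range (splitPoly k)) then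
    (Module.Basis.mk hb.1 hb.2).constr ℚ fun p => if p.first = j then splitPoly k p else 0
  else 0

/-- The recursion `s_{()}^(k) = 1`, `s_λ^(k) = T_{λ_1}^(k) (s_{λ_1} s_{(λ_2, λ_3, …)}^(k))`. -/
def kSchurList (k : ℕ) : (l : List ℕ) → (∀ x ∈ l, x ≤ k) → ringK k
  | [], _ => 1
  | a :: l, hb => proj k a
      (schurK k [a] (List.pairwise_singleton _ a) (hb a List.mem_cons_self) *
        kSchurList k l fun x hx => hb x (List.mem_cons_of_mem a hx))

/-- The `k`-Schur function `s_λ^(k)` of a `k`-bounded partition `λ`. -/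
def kSchur {k : ℕ} (p : BoundedPartition k) : ringK k :=
  kSchurList k p.1 fun x hx => (p.2.2 x hx).2

/-- The Schur function of the `k`-rectangle `(ℓ^{k+1-ℓ})`, for `1 ≤ ℓ ≤ k`. -/
def rectSchur (k : ℕ) (l : Set.Icc 1 k) : ringK k :=
  schurK k (List.replicate (k + 1 - l) l) (List.pairwise_replicate.2 (Or.inr le_rfl)) (by
    have h1 := l.2.1
    have h2 := l.2.2
    obtain ⟨n, hn⟩ : ∃ n, k + 1 - (l : ℕ) = n + 1 := ⟨k - l, by omega⟩
    rw [hn, List.replicate_succ]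
    simp only [mainHook, List.headD_cons, List.length_cons, List.length_replicate]
    omega)

/-- The ideal `I_k` of `Λ^(k)` generated by the Schur functions of the `k`-rectangles. -/
def rectIdeal (k : ℕ) : Ideal (ringK k) := Ideal.span (Set.range (rectSchur k))

end KSchur

end

/-! Give $h_r$ the weight $r(k-r)$ and extend it additively to monomials in $h_1,\dots,h_k$, which
form a basis of $\Lambda^{(k)}$. Expanding Jacobi-Trudi, every nonzero term of $s_\lambda$ other
than $h_\lambda$ has the same index sum but a strictly larger sum of squared indices, hence strictly
smaller weight (`lead_schurK`). So $s_\lambda = h_\lambda$ + lower weight whenever $h_M(\lambda)\le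
k$. This form is stable under products, so it holds for the $G^{(k)}_\lambda$. The projections
$T^{(k)}_j$ therefore respect the weight filtration, and the recursion gives $s^{(k)}_\lambda =
h_\lambda$ + lower weight (`lead_kSchur`).

Divide each multiplicity $a_\ell$ of a partition by $k+1-\ell$. The quotients count rectangles, and
the remainders give an irreducible partition. The products of these rectangle Schur functions with
the $k$-Schur function of the remainder are again unitriangular over the monomials, hence a basis
(`rectProd`). Multiplication by a rectangle only shifts the index of this basis, so $\mathcal I_k$
is spanned by the members that contain a rectangle. The other members, the irreducible $k$-Schur
functions, form a basis of the quotient. No rectangle factorization property of $k$-Schur functions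
is needed. -/

noncomputable section

namespace KSchur

/-! ### Elementary symmetric functions and the algebraic independence of $h_1,\dots,h_k$ -/

open Classical in
/-- The elementary symmetric function `e_n`, the sum of all squarefree monomials of degree `n`. -/
def elem (n : ℕ) : MvPowerSeries ℕ ℚ :=
  fun m => if m.degree = n ∧ ∀ i, m i ≤ 1 then 1 else 0

theorem coeff_h (r : ℤ) (m : ℕ →₀ ℕ) :
    MvPowerSeries.coeff m (h r) = if (m.degree : ℤ) = r then 1 else 0 := rfl

open Classical in
theorem coeff_elem (n : ℕ) (m : ℕ →₀ ℕ) :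
    MvPowerSeries.coeff m (elem n) = if m.degree = n ∧ ∀ i, m i ≤ 1 then 1 else 0 := rfl

theorem h_zero : h 0 = 1 := by
  ext m
  rw [MvPowerSeries.coeff_one, coeff_h]
  simp [Finsupp.degree_eq_zero_iff]

theorem h_of_neg {r : ℤ} (hr : r < 0) : h r = 0 := by
  ext m
  rw [coeff_h, if_neg (by omega), map_zero]

/-- The squarefree monomial with support `s`. -/
def squarefreeExp {σ : Type*} (s : Finset σ) : σ →₀ ℕ := ∑ i ∈ s, Finsupp.single i 1

theorem squarefreeExp_apply {σ : Type*} [DecidableEq σ] (s : Finset σ) (i : σ) :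
    squarefreeExp s i = if i ∈ s then 1 else 0 := by
  simp [squarefreeExp, Finsupp.finsetSum_apply, Finsupp.single_apply]

theorem degree_squarefreeExp {σ : Type*} (s : Finset σ) : (squarefreeExp s).degree = s.card := by
  simp [squarefreeExp, map_sum]

theorem squarefreeExp_support {σ : Type*} {m : σ →₀ ℕ} (hm : ∀ i, m i ≤ 1) :
    squarefreeExp m.support = m := by
  classical
  ext i
  rw [squarefreeExp_apply]
  have := hm i
  by_cases h0 : m i = 0 <;> simp [h0]
  omega

theorem support_squarefreeExp {σ : Type*} (s : Finset σ) : (squarefreeExp s).support = s := by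
  classical
  ext i
  simp [squarefreeExp_apply]

-- The squarefree divisors of a monomial correspond to the subsets of its support, so this is the
-- alternating sum over subsets of a nonempty set. It is the coefficient of the monomial in $\sum_i
-- (-1)^i e_i h_{n-i}$.
open Classical in
theorem sum_antidiagonal_squarefree (m : ℕ →₀ ℕ) (hm : m ≠ 0) :
    ∑ p ∈ Finset.HasAntidiagonal.antidiagonal m,
      (if ∀ i, p.1 i ≤ 1 then (-1 : ℚ) ^ p.1.degree else 0) = 0 := by
  classical
  have key : ∑ s ∈ m.support.powerset, (-1 : ℚ) ^ s.card = 0 := by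
    have := Finset.sum_powerset_neg_one_pow_card_of_nonempty (Finsupp.support_nonempty_iff.2 hm)
    exact_mod_cast congrArg (Int.cast : ℤ → ℚ) this
  rw [← Finset.sum_filter, ← key]
  refine Finset.sum_nbij' (fun p => p.1.support)
    (fun s => (squarefreeExp s, m - squarefreeExp s)) ?_ ?_ ?_ ?_ ?_
  · intro p hp
    rw [Finset.mem_filter, Finset.HasAntidiagonal.mem_antidiagonal] at hp
    rw [Finset.mem_powerset, ← hp.1]
    intro i hi
    simp only [Finsupp.mem_support_iff, Finsupp.add_apply] at hi ⊢
    omega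
  · intro s hs
    rw [Finset.mem_powerset] at hs
    rw [Finset.mem_filter, Finset.HasAntidiagonal.mem_antidiagonal]
    refine ⟨add_tsub_cancel_of_le fun i => ?_, fun i => ?_⟩
    · rw [squarefreeExp_apply]
      split_ifs with hi
      · have := Finsupp.mem_support_iff.1 (hs hi)
        omega
      · exact Nat.zero_le _
    · dsimp only
      rw [squarefreeExp_apply]
      split_ifs <;> omega
  · intro p hp
    rw [Finset.mem_filter, Finset.HasAntidiagonal.mem_antidiagonal] at hp
    rw [squarefreeExp_support hp.2, ← hp.1, add_tsub_cancel_left]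
  · intro s _
    exact support_squarefreeExp s
  · intro p hp
    rw [Finset.mem_filter] at hp
    conv_lhs => rw [← squarefreeExp_support hp.2, degree_squarefreeExp]

theorem sum_elem_mul_h {n : ℕ} (hn : n ≠ 0) :
    ∑ p ∈ Finset.HasAntidiagonal.antidiagonal n, (-1 : ℚ) ^ p.1 • (elem p.1 * h p.2) = 0 := by
  classical
  ext m
  simp only [map_sum, map_smul, MvPowerSeries.coeff_mul, map_zero, smul_eq_mul, Finset.mul_sum,
    coeff_elem, coeff_h]
  rw [Finset.sum_comm]
  by_cases hm : m.degree = n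
  · have hm0 : m ≠ 0 := by
      rintro rfl
      exact hn (by simpa using hm.symm)
    refine Eq.trans ?_ (sum_antidiagonal_squarefree m hm0)
    refine Finset.sum_congr rfl fun q hq => ?_
    rw [Finset.HasAntidiagonal.mem_antidiagonal] at hq
    have hd : q.1.degree + q.2.degree = n := by rw [← hm, ← hq, map_add]
    -- A fixed factorization of the monomial contributes to $e_i h_{n-i}$ for only one $i$, the
    -- degree of its first factor.
    rw [Finset.sum_eq_single (q.1.degree, q.2.degree)]
    · simp
    · intro b _ hb
      by_cases h1 : q.1.degree = b.1
      · have h2 : q.2.degree ≠ b.2 := fun h2 => hb (Prod.ext h1.symm h2.symm)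
        simp [h2]
      · simp [h1]
    · intro hnot
      exact absurd (Finset.HasAntidiagonal.mem_antidiagonal.2 hd) hnot
  · refine Finset.sum_eq_zero fun q hq => Finset.sum_eq_zero fun b hb => ?_
    rw [Finset.HasAntidiagonal.mem_antidiagonal] at hq hb
    by_cases h1 : q.1.degree = b.1
    · have h2 : q.2.degree ≠ b.2 := fun h2 => hm (by rw [← hq, map_add, h1, h2, hb])
      simp [h2]
    · simp [h1]

/-- The alternating relation between the $e_i$ and the $h_j$ expresses $e_n$ recursively through
earlier $e_i$ and $h_1,\dots,h_n$. -/
theorem elem_mem {k n : ℕ} (hn : n ≤ k) : elem n ∈ ringK k := by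
  induction n using Nat.strong_induction_on with
  | _ n ih =>
    rcases Nat.eq_zero_or_pos n with rfl | hpos
    · have : elem 0 = 1 := by
        ext m
        rw [MvPowerSeries.coeff_one, coeff_elem]
        by_cases hm : m = 0 <;> simp [hm, Finsupp.degree_eq_zero_iff]
      rw [this]
      exact one_mem _
    · have hs := sum_elem_mul_h hpos.ne'
      rw [← Finset.add_sum_erase _ _
        (show (n, 0) ∈ Finset.HasAntidiagonal.antidiagonal n by simp [Finset.HasAntidiagonal.mem_antidiagonal])] at hs
      simp only [Nat.cast_zero, h_zero, mul_one] at hs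
      have he : (-1 : ℚ) ^ n • elem n ∈ ringK k := by
        rw [eq_neg_of_add_eq_zero_left hs]
        refine neg_mem (sum_mem fun p hp => Subalgebra.smul_mem _ (mul_mem (ih _ ?_ ?_) ?_) _)
        · rw [Finset.mem_erase, Finset.HasAntidiagonal.mem_antidiagonal] at hp
          rcases Nat.lt_or_ge p.1 n with h1 | h1
          · exact h1
          · exact absurd (Prod.ext (by dsimp only; omega) (by dsimp only; omega)) hp.1
        · rw [Finset.mem_erase, Finset.HasAntidiagonal.mem_antidiagonal] at hp
          omega
        · rw [Finset.mem_erase, Finset.HasAntidiagonal.mem_antidiagonal] at hp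
          exact h_mem (by omega)
      have := Subalgebra.smul_mem _ he ((-1 : ℚ) ^ n)
      rwa [smul_smul, ← mul_pow, neg_one_mul, neg_neg, one_pow, one_smul] at this

theorem killCompl_elem (k n : ℕ) :
    MvPowerSeries.killCompl Fin.valEmbedding (elem n) =
      ((MvPolynomial.esymm (Fin k) ℚ n : MvPolynomial (Fin k) ℚ) : MvPowerSeries (Fin k) ℚ) := by
  classical
  ext m
  rw [MvPowerSeries.coeff_killCompl, coeff_elem, MvPolynomial.coeff_coe,
    MvPolynomial.esymm_eq_sum_monomial, MvPolynomial.coeff_sum]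
  simp only [MvPolynomial.coeff_monomial]
  have hdeg : (Finsupp.embDomain (Fin.valEmbedding (n := k)) m).degree = m.degree := by
    rw [Finsupp.degree_apply, Finsupp.degree_apply, Finsupp.support_embDomain, Finset.sum_map]
    simp only [Finsupp.embDomain_apply_self]
  have hle : (∀ i, Finsupp.embDomain (Fin.valEmbedding (n := k)) m i ≤ 1) ↔ ∀ i, m i ≤ 1 := by
    constructor
    · intro H i
      have := H (Fin.valEmbedding i)
      rwa [Finsupp.embDomain_apply_self] at this
    · intro H i
      by_cases hi : i ∈ Set.range (Fin.valEmbedding (n := k))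
      · obtain ⟨j, rfl⟩ := hi
        rw [Finsupp.embDomain_apply_self]
        exact H j
      · rw [Finsupp.embDomain_of_notMem_range _ _ _ hi]
        exact Nat.zero_le _
  rw [hdeg, hle]
  split_ifs with hm
  · rw [Finset.sum_eq_single m.support]
    · exact (if_pos (squarefreeExp_support hm.2)).symm
    · intro s _ hs
      refine if_neg fun e => hs ?_
      rw [← support_squarefreeExp s]
      exact congrArg Finsupp.support e
    · intro hs
      refine absurd (Finset.mem_powersetCard.2 ⟨Finset.subset_univ _, ?_⟩) hs
      rw [← degree_squarefreeExp, squarefreeExp_support hm.2, hm.1]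
  · refine (Finset.sum_eq_zero fun s hs => if_neg fun e => hm ?_).symm
    change squarefreeExp s = m at e
    rw [Finset.mem_powersetCard] at hs
    refine ⟨by rw [← e, degree_squarefreeExp, hs.2], fun i => ?_⟩
    rw [← e, squarefreeExp_apply]
    split_ifs <;> omega

/-- The complete symmetric function `h_r` as an element of `Λ^(k)`. -/
def hK (k : ℕ) (r : ℤ) (hr : r ≤ k) : ringK k := ⟨h r, h_mem hr⟩

/-- The generator `h_{i+1}` of `Λ^(k)`. -/
def gen (k : ℕ) (i : Fin k) : ringK k := hK k ((i : ℕ) + 1 : ℕ) (by have := i.2; omega)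

theorem range_val_gen (k : ℕ) :
    (ringK k).val '' Set.range (gen k) = h '' Set.Icc 1 (k : ℤ) := by
  ext x
  constructor
  · rintro ⟨_, ⟨i, rfl⟩, rfl⟩
    exact ⟨((i : ℕ) + 1 : ℕ), ⟨by omega, by have := i.2; omega⟩, rfl⟩
  · rintro ⟨r, ⟨h1, h2⟩, rfl⟩
    refine ⟨_, ⟨⟨(r - 1).toNat, by omega⟩, rfl⟩, ?_⟩
    change h _ = h r
    congr 1
    dsimp only
    omega

theorem adjoin_gen (k : ℕ) : Algebra.adjoin ℚ (Set.range (gen k)) = ⊤ := by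
  apply Subalgebra.map_injective (f := (ringK k).val) Subtype.val_injective
  rw [AlgHom.map_adjoin, range_val_gen, Algebra.map_top, Subalgebra.range_val]
  rfl

/-- Setting all but $k$ variables to zero turns $e_1,\dots,e_k$ into the elementary symmetric
polynomials in $k$ variables, where independence is the fundamental theorem. Independence of the
images lifts back. -/
theorem algebraicIndependent_elem (k : ℕ) :
    AlgebraicIndependent ℚ (fun i : Fin k => (⟨elem (i + 1), elem_mem i.2⟩ : ringK k)) := by
  let φ : ringK k →ₐ[ℚ] MvPowerSeries (Fin k) ℚ :=
    (MvPowerSeries.killCompl Fin.valEmbedding).comp (ringK k).val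
  refine AlgebraicIndependent.of_comp φ ?_
  have h1 : AlgebraicIndependent ℚ (fun i : Fin k => MvPolynomial.esymm (Fin k) ℚ (i + 1)) := by
    rw [AlgebraicIndependent]
    intro p q hpq
    refine MvPolynomial.esymmAlgHom_fin_injective ℚ (le_refl k) (Subtype.ext ?_)
    rwa [MvPolynomial.esymmAlgHom_apply, MvPolynomial.esymmAlgHom_apply]
  have h2 := h1.map' (f := MvPolynomial.coeToMvPowerSeries.algHom (σ := Fin k) (R := ℚ) ℚ) (by
    intro p q hpq
    simpa [MvPolynomial.coeToMvPowerSeries.algHom_apply] using hpq)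
  convert h2 using 1
  funext i
  change MvPowerSeries.killCompl Fin.valEmbedding (elem (i + 1)) = _
  rw [killCompl_elem]
  simp [MvPolynomial.coeToMvPowerSeries.algHom_apply]

/-- The $e_i$ force transcendence degree at least $k$, and $k$ generators of an algebra of that
transcendence degree cannot satisfy a relation. -/
theorem algebraicIndependent_gen (k : ℕ) : AlgebraicIndependent ℚ (gen k) := by
  have : Algebra.IsAlgebraic (Algebra.adjoin ℚ (Set.range (gen k))) (ringK k) := by
    refine ⟨fun a => ?_⟩
    have ha : a ∈ Algebra.adjoin ℚ (Set.range (gen k)) := by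
      rw [adjoin_gen]
      trivial
    exact isAlgebraic_algebraMap (⟨a, ha⟩ : Algebra.adjoin ℚ (Set.range (gen k)))
  exact (Algebra.IsAlgebraic.isTranscendenceBasis_of_le_trdeg_of_finite ℚ (gen k)
    (algebraicIndependent_elem k).cardinalMk_le_trdeg).1

/-! ### Unitriangular families with respect to a weight -/

/-- A family that agrees with a basis up to terms of strictly smaller weight generates every
basis vector through members of at most its weight. -/
theorem mem_span_of_triangular {ι K V : Type*} [Ring K] [AddCommGroup V] [Module K V]
    (b f : ι → V) (w : ι → ℕ)
    (hf : ∀ i, f i - b i ∈ Submodule.span K (b '' {j | w j < w i})) (i : ι) :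
    b i ∈ Submodule.span K (f '' {j | w j ≤ w i}) := by
  induction hn : w i using Nat.strong_induction_on generalizing i with
  | _ n ih =>
    subst hn
    have h1 : Submodule.span K (b '' {j | w j < w i}) ≤
        Submodule.span K (f '' {j | w j ≤ w i}) := by
      rw [Submodule.span_le]
      rintro _ ⟨j, hj, rfl⟩
      refine Submodule.span_mono (Set.image_mono fun c hc => ?_) (ih (w j) hj j rfl)
      exact le_trans (show w c ≤ w j from hc) (le_of_lt (show w j < w i from hj))
    have h2 : f i ∈ Submodule.span K (f '' {j | w j ≤ w i}) :=
      Submodule.subset_span ⟨i, le_refl (w i), rfl⟩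
    have h3 := Submodule.sub_mem _ h2 (h1 (hf i))
    rwa [sub_sub_cancel] at h3

theorem span_lt_eq_of_triangular {ι K V : Type*} [Ring K] [AddCommGroup V] [Module K V]
    (b f : ι → V) (w : ι → ℕ)
    (hf : ∀ i, f i - b i ∈ Submodule.span K (b '' {j | w j < w i})) (n : ℕ) :
    Submodule.span K (b '' {j | w j < n}) ≤ Submodule.span K (f '' {j | w j < n}) := by
  rw [Submodule.span_le]
  rintro _ ⟨i, hi, rfl⟩
  exact Submodule.span_mono (Set.image_mono fun c hc =>
    lt_of_le_of_lt (show w c ≤ w i from hc) (show w i < n from hi))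
    (mem_span_of_triangular b f w hf i)

theorem top_le_span_of_triangular {ι K V : Type*} [Ring K] [AddCommGroup V] [Module K V]
    (b : Module.Basis ι K V) (f : ι → V) (w : ι → ℕ)
    (hf : ∀ i, f i - b i ∈ Submodule.span K (b '' {j | w j < w i})) :
    ⊤ ≤ Submodule.span K (Set.range f) := by
  rw [← b.span_eq, Submodule.span_le]
  rintro _ ⟨i, rfl⟩
  exact Submodule.span_mono (Set.image_subset_range _ _) (mem_span_of_triangular b f w hf i)

/-- In a vanishing combination, take an index of maximal weight among those with nonzero
coefficient. Its basis vector occurs in no other term, so that coefficient is zero. A weight level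
may be infinite, since only finite combinations matter. -/
theorem linearIndependent_of_triangular {ι K V : Type*} [Ring K] [AddCommGroup V] [Module K V]
    (b : Module.Basis ι K V) (f : ι → V) (w : ι → ℕ)
    (hf : ∀ i, f i - b i ∈ Submodule.span K (b '' {j | w j < w i})) :
    LinearIndependent K f := by
  classical
  rw [linearIndependent_iff']
  intro s g hg
  by_contra! hne
  have hs : (s.filter fun i => g i ≠ 0).Nonempty := by
    obtain ⟨i, hi, h0⟩ := hne
    exact ⟨i, Finset.mem_filter.2 ⟨hi, h0⟩⟩
  obtain ⟨i, hi, hmax⟩ := Finset.exists_max_image _ w hs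
  rw [Finset.mem_filter] at hi
  have hcoord : ∀ j ∈ s, g j ≠ 0 → b.repr (f j - b j) i = 0 := by
    intro j hj h0
    have hle : w j ≤ w i := hmax j (Finset.mem_filter.2 ⟨hj, h0⟩)
    by_contra hc
    have := (b.mem_span_image.1 (hf j)) (Finsupp.mem_support_iff.2 hc)
    exact absurd (show w i < w j from this) (by omega)
  have h0 := congrArg (fun v => b.repr v i) hg
  simp only [map_sum, map_smul, Finsupp.finsetSum_apply, Finsupp.smul_apply, smul_eq_mul,
    map_zero, Finsupp.zero_apply] at h0
  rw [Finset.sum_eq_single i] at h0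
  · have h1 := hcoord i hi.1 hi.2
    rw [map_sub, Finsupp.sub_apply, sub_eq_zero, b.repr_self, Finsupp.single_eq_same] at h1
    rw [h1, mul_one] at h0
    exact hi.2 h0
  · intro j hj hji
    by_cases hgj : g j = 0
    · rw [hgj, zero_mul]
    · have h1 := hcoord j hj hgj
      rw [map_sub, Finsupp.sub_apply, sub_eq_zero, b.repr_self,
        Finsupp.single_eq_of_ne (Ne.symm hji)] at h1
      rw [h1, mul_zero]
  · exact fun hn => absurd hi.1 hn

/-! ### The monomial basis, the weight filtration and leading monomials -/

/-- The basis of `Λ^(k)` consisting of the monomials in `h_1, …, h_k`. -/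
def mon (k : ℕ) : Module.Basis (Fin k →₀ ℕ) ℚ (ringK k) :=
  (MvPolynomial.basisMonomials (Fin k) ℚ).map
    (AlgEquiv.ofBijective (MvPolynomial.aeval (gen k)) ⟨algebraicIndependent_gen k, by
      rw [← AlgHom.range_eq_top, ← Algebra.adjoin_range_eq_range_aeval, adjoin_gen]⟩).toLinearEquiv

theorem mon_eq (k : ℕ) (a : Fin k →₀ ℕ) :
    mon k a = MvPolynomial.aeval (gen k) (MvPolynomial.monomial a (1 : ℚ)) := by
  simp only [mon, Module.Basis.map_apply, MvPolynomial.coe_basisMonomials]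
  rfl

theorem mon_zero (k : ℕ) : mon k 0 = 1 := by
  rw [mon_eq, ← MvPolynomial.one_def, map_one]

theorem mon_add {k : ℕ} (a b : Fin k →₀ ℕ) : mon k (a + b) = mon k a * mon k b := by
  rw [mon_eq, mon_eq, mon_eq, ← map_mul, MvPolynomial.monomial_mul, one_mul]

theorem mon_single {k : ℕ} (i : Fin k) : mon k (Finsupp.single i 1) = gen k i := by
  rw [mon_eq]
  simp [MvPolynomial.aeval_monomial]

theorem mon_sum {k : ℕ} {ι : Type*} (s : Finset ι) (a : ι → Fin k →₀ ℕ) :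
    mon k (∑ i ∈ s, a i) = ∏ i ∈ s, mon k (a i) := by
  classical
  induction s using Finset.induction_on with
  | empty => simp [mon_zero]
  | insert i s hi ih => rw [Finset.sum_insert hi, Finset.prod_insert hi, mon_add, ih]

/-- The weight of an exponent vector: the generator `h_r` has weight `r * (k - r)`. -/
def wt {k : ℕ} : (Fin k →₀ ℕ) →+ ℕ where
  toFun a := ∑ i, a i * ((i + 1) * (k - (i + 1)))
  map_zero' := by simp
  map_add' a b := by simp [add_mul, Finset.sum_add_distrib]

/-- The span of the monomials of weight less than `n`. -/
def low (k n : ℕ) : Submodule ℚ (ringK k) := Submodule.span ℚ (mon k '' {a | wt a < n})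

theorem mon_mem_low {k n : ℕ} {a : Fin k →₀ ℕ} (h : wt a < n) : mon k a ∈ low k n :=
  Submodule.subset_span ⟨a, h, rfl⟩

theorem low_mono {k m n : ℕ} (h : m ≤ n) : low k m ≤ low k n :=
  Submodule.span_mono (Set.image_mono fun _ ha => lt_of_lt_of_le ha h)

theorem mon_mul_mem_low {k n : ℕ} (a : Fin k →₀ ℕ) {x : ringK k} (hx : x ∈ low k n) :
    mon k a * x ∈ low k (wt a + n) := by
  induction hx using Submodule.span_induction with
  | mem x hx =>
    obtain ⟨b, hb, rfl⟩ := hx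
    rw [← mon_add]
    refine mon_mem_low ?_
    rw [map_add]
    exact Nat.add_lt_add_left hb _
  | zero => rw [mul_zero]; exact zero_mem _
  | add x y _ _ ihx ihy => rw [mul_add]; exact add_mem ihx ihy
  | smul c x _ ih => rw [mul_smul_comm]; exact Submodule.smul_mem _ _ ih

theorem mul_mem_low {k m n : ℕ} {x y : ringK k} (hx : x ∈ low k m) (hy : y ∈ low k n) :
    x * y ∈ low k (m + n) := by
  induction hx using Submodule.span_induction with
  | mem x hx =>
    obtain ⟨a, ha, rfl⟩ := hx
    exact low_mono (Nat.add_le_add_right (le_of_lt ha) _) (mon_mul_mem_low a hy)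
  | zero => rw [zero_mul]; exact zero_mem _
  | add x y _ _ ihx ihy => rw [add_mul]; exact add_mem ihx ihy
  | smul c x _ ih => rw [smul_mul_assoc]; exact Submodule.smul_mem _ _ ih

/-- `f` is the monomial with exponent vector `a` plus terms of smaller weight. -/
def Lead {k : ℕ} (f : ringK k) (a : Fin k →₀ ℕ) : Prop := f - mon k a ∈ low k (wt a)

theorem lead_mon {k : ℕ} (a : Fin k →₀ ℕ) : Lead (mon k a) a := by
  rw [Lead, sub_self]
  exact zero_mem _

theorem lead_one (k : ℕ) : Lead (1 : ringK k) 0 := by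
  rw [← mon_zero]
  exact lead_mon 0

theorem Lead.mul {k : ℕ} {f g : ringK k} {a b : Fin k →₀ ℕ} (hf : Lead f a) (hg : Lead g b) :
    Lead (f * g) (a + b) := by
  have e : f * g - mon k (a + b) = (f - mon k a) * (g - mon k b) + mon k a * (g - mon k b) +
      mon k b * (f - mon k a) := by
    rw [mon_add]
    ring
  rw [Lead, e, map_add]
  refine add_mem (add_mem (mul_mem_low hf hg) (mon_mul_mem_low a hg)) ?_
  rw [add_comm (wt a)]
  exact mon_mul_mem_low b hf

theorem Lead.pow {k : ℕ} {f : ringK k} {a : Fin k →₀ ℕ} (hf : Lead f a) (n : ℕ) :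
    Lead (f ^ n) (n • a) := by
  induction n with
  | zero => rw [pow_zero, zero_smul]; exact lead_one k
  | succ n ih => rw [pow_succ, succ_nsmul]; exact ih.mul hf

theorem lead_prod {k : ℕ} {ι : Type*} (s : Finset ι) {f : ι → ringK k} {a : ι → Fin k →₀ ℕ}
    (hf : ∀ i, Lead (f i) (a i)) : Lead (∏ i ∈ s, f i) (∑ i ∈ s, a i) := by
  classical
  induction s using Finset.induction_on with
  | empty => simpa using lead_one k
  | insert i s hi ih =>
    rw [Finset.sum_insert hi, Finset.prod_insert hi]
    exact (hf i).mul ih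

/-! ### Leading monomials of Schur functions -/

/-- The exponent vector of `h_r`, which is `0` for `r = 0`. -/
def part (k r : ℕ) : Fin k →₀ ℕ :=
  Finsupp.equivFunOnFinite.symm fun i => if (i : ℕ) + 1 = r then 1 else 0

theorem part_apply {k : ℕ} (r : ℕ) (i : Fin k) : part k r i = if (i : ℕ) + 1 = r then 1 else 0 :=
  rfl

theorem part_succ {k : ℕ} (i : Fin k) : part k (i + 1) = Finsupp.single i 1 := by
  classical
  ext j
  rw [part_apply, Finsupp.single_apply]
  simp [Fin.ext_iff, eq_comm]

theorem part_zero (k : ℕ) : part k 0 = 0 := by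
  ext j
  simp [part_apply]

theorem wt_part {k r : ℕ} (hr : r ≤ k) : wt (part k r) = r * (k - r) := by
  rcases r with _ | r
  · rw [part_zero, map_zero, zero_mul]
  · change ∑ i : Fin k, _ = _
    rw [Finset.sum_eq_single ⟨r, hr⟩]
    · rw [part_apply, if_pos rfl, one_mul]
    · intro i _ hi
      rw [part_apply, if_neg, zero_mul]
      intro e
      exact hi (Fin.ext (by simpa using e))
    · simp

theorem hK_eq_mon {k r : ℕ} (hr : r ≤ k) :
    hK k r (by exact_mod_cast hr) = mon k (part k r) := by
  rcases r with _ | r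
  · rw [part_zero, mon_zero]
    exact Subtype.ext h_zero
  · rw [part_succ ⟨r, hr⟩, mon_single]
    rfl

/-- The exponent vector of `h_λ`. -/
def expo (k : ℕ) (l : List ℕ) : Fin k →₀ ℕ := (l.map (part k)).sum

theorem expo_nil (k : ℕ) : expo k [] = 0 := rfl

theorem expo_cons (k a : ℕ) (l : List ℕ) : expo k (a :: l) = part k a + expo k l := by
  simp [expo]

theorem expo_append (k : ℕ) (l m : List ℕ) : expo k (l ++ m) = expo k l + expo k m := by
  simp [expo]

theorem expo_apply {k : ℕ} (l : List ℕ) (i : Fin k) : expo k l i = l.count ((i : ℕ) + 1) := by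
  induction l with
  | nil => rfl
  | cons a l ih =>
    rw [expo_cons, Finsupp.add_apply, ih, part_apply, List.count_cons, add_comm]
    simp only [beq_iff_eq, eq_comm (a := a)]

theorem expo_eq_sum (k : ℕ) (l : List ℕ) : expo k l = ∑ i : Fin l.length, part k (l.get i) := by
  rw [expo]
  conv_lhs => rw [← List.ofFn_get l, List.map_ofFn, List.sum_ofFn]
  rfl

/-- In the expanded square, the cross term is nonnegative by the rearrangement inequality, because
`x` and the position are oppositely ordered. The squared displacement of a nontrivial permutation is
positive. -/
theorem sum_sq_lt_of_perm_ne_one {n : ℕ} (x : Fin n → ℤ) (hx : Antitone x)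
    {σ : Equiv.Perm (Fin n)} (hσ : σ ≠ 1) :
    ∑ i, x i ^ 2 < ∑ i, (x (σ i) + (i : ℕ) - (σ i : ℕ)) ^ 2 := by
  have hanti : Antivary x (fun i : Fin n => ((i : ℕ) : ℤ)) := by
    intro i j hij
    exact hx (le_of_lt (by simpa using hij))
  have h1 := hanti.sum_mul_le_sum_comp_perm_mul (σ := σ)
  have h2 : ∑ i, x (σ i) ^ 2 = ∑ i, x i ^ 2 := Equiv.sum_comp σ fun i => x i ^ 2
  have h3 : ∑ i, x (σ i) * ((σ i : ℕ) : ℤ) = ∑ i, x i * ((i : ℕ) : ℤ) :=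
    Equiv.sum_comp σ fun i => x i * ((i : ℕ) : ℤ)
  have h4 : 0 < ∑ i : Fin n, (((i : ℕ) : ℤ) - (σ i : ℕ)) ^ 2 := by
    obtain ⟨i, hi⟩ : ∃ i, σ i ≠ i := by
      by_contra! h
      exact hσ (Equiv.ext h)
    refine Finset.sum_pos' (fun j _ => sq_nonneg _) ⟨i, Finset.mem_univ i, ?_⟩
    refine sq_pos_of_ne_zero fun h => hi (Fin.ext ?_)
    omega
  have h5 : ∑ i, (x (σ i) + (i : ℕ) - (σ i : ℕ)) ^ 2 = ∑ i, x (σ i) ^ 2 +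
      2 * (∑ i, x (σ i) * ((i : ℕ) : ℤ) - ∑ i, x (σ i) * ((σ i : ℕ) : ℤ)) +
      ∑ i : Fin n, (((i : ℕ) : ℤ) - (σ i : ℕ)) ^ 2 := by
    rw [← Finset.sum_sub_distrib, Finset.mul_sum, ← Finset.sum_add_distrib,
      ← Finset.sum_add_distrib]
    exact Finset.sum_congr rfl fun i _ => by ring
  rw [h5, h2, h3]
  linarith

theorem lead_schurK {k : ℕ} {l : List ℕ} (hl : l.Pairwise (· ≥ ·)) (hk : mainHook l ≤ k) :
    Lead (schurK k l hl hk) (expo k l) := by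
  have hle : ∀ i : Fin l.length, l.get i ≤ k := fun i => by
    have h1 := get_le_headD hl i
    have h2 := i.2
    unfold mainHook at hk
    omega
  have hle' : ∀ i j : Fin l.length, (l.get i : ℤ) + (j : ℕ) - (i : ℕ) ≤ k := fun i j => by
    have h1 := get_le_headD hl i
    have h2 := j.2
    unfold mainHook at hk
    omega
  have hdet : schurK k l hl hk =
      Matrix.det (Matrix.of fun i j : Fin l.length =>
        hK k ((l.get i : ℤ) + (j : ℕ) - (i : ℕ)) (hle' i j)) := by
    apply Subtype.val_injective
    change schur l = (ringK k).val.toRingHom _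
    rw [RingHom.map_det]
    rfl
  have hone : ∏ i, hK k ((l.get i : ℤ) + (i : ℕ) - (i : ℕ)) (hle' i i) = mon k (expo k l) := by
    rw [expo_eq_sum, mon_sum]
    refine Finset.prod_congr rfl fun i _ => ?_
    rw [← hK_eq_mon (hle i)]
    apply Subtype.ext
    change h _ = h _
    congr 1
    ring
  rw [Lead, hdet, Matrix.det_apply, ← Finset.add_sum_erase _ _ (Finset.mem_univ 1)]
  simp only [Equiv.Perm.sign_one, one_smul, Equiv.Perm.coe_one, id_eq, Matrix.of_apply]
  rw [hone, add_sub_cancel_left]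
  refine sum_mem fun σ hσ => ?_
  rw [Units.smul_def]
  refine zsmul_mem ?_ _
  have hσ1 : σ ≠ 1 := (Finset.mem_erase.1 hσ).1
  -- A term with a negative index vanishes. Any other term is a monomial in the generators, all
  -- indices being at most $k$ by the hook bound.
  by_cases hneg : ∃ i, (l.get (σ i) : ℤ) + (i : ℕ) - (σ i : ℕ) < 0
  · obtain ⟨i, hi⟩ := hneg
    rw [Finset.prod_eq_zero (Finset.mem_univ i)]
    · exact zero_mem _
    · exact Subtype.ext (h_of_neg hi)
  · push Not at hneg
    choose r hr using fun i => Int.eq_ofNat_of_zero_le (hneg i)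
    have hrk : ∀ i, r i ≤ k := fun i => by
      have := hle' (σ i) i
      rw [hr] at this
      exact_mod_cast this
    have hprod : ∏ i, hK k ((l.get (σ i) : ℤ) + (i : ℕ) - (σ i : ℕ)) (hle' (σ i) i) =
        mon k (∑ i, part k (r i)) := by
      rw [mon_sum]
      refine Finset.prod_congr rfl fun i _ => ?_
      rw [← hK_eq_mon (hrk i)]
      exact Subtype.ext (congrArg h (hr i))
    rw [hprod]
    refine mon_mem_low ?_
    rw [expo_eq_sum, map_sum, map_sum, Finset.sum_congr rfl fun i _ => wt_part (hrk i),
      Finset.sum_congr rfl fun i _ => wt_part (hle i)]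
    have hanti : Antitone fun i => (l.get i : ℤ) := fun i j hij => by
      rcases hij.lt_or_eq with h | rfl
      · exact Nat.cast_le.2 (List.pairwise_iff_get.1 hl i j h)
      · exact le_rfl
    have hsq := sum_sq_lt_of_perm_ne_one _ hanti hσ1
    have hlin : ∑ i, ((l.get (σ i) : ℤ) + (i : ℕ) - (σ i : ℕ)) = ∑ i, (l.get i : ℤ) := by
      rw [Finset.sum_sub_distrib, Finset.sum_add_distrib,
        Equiv.sum_comp σ fun i => (l.get i : ℤ),
        Equiv.sum_comp σ fun i : Fin l.length => ((i : ℕ) : ℤ), add_sub_cancel_right]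
    -- Weight is $k$ times the index sum minus the sum of squares. The permutation preserves the
    -- index sum, so only the squares need comparing.
    have hw : ∀ s : Fin l.length → ℕ, (∀ i, s i ≤ k) →
        ((∑ i, s i * (k - s i) : ℕ) : ℤ) = k * ∑ i, (s i : ℤ) - ∑ i, (s i : ℤ) ^ 2 := by
      intro s hs
      rw [Nat.cast_sum, Finset.mul_sum, ← Finset.sum_sub_distrib]
      refine Finset.sum_congr rfl fun i _ => ?_
      rw [Nat.cast_mul, Nat.cast_sub (hs i)]
      ring
    simp only [hr] at hsq hlin
    zify
    have e1 := hw r hrk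
    have e2 := hw (fun i => l.get i) hle
    push_cast at e1 e2 ⊢
    rw [e1, e2, hlin]
    linarith

/-! ### Split polynomials, projections and $k$-Schur functions -/

theorem expo_injective {k : ℕ} :
    Function.Injective fun p : BoundedPartition k => expo k p.1 := by
  intro p q hpq
  apply Subtype.ext
  refine List.Perm.eq_of_pairwise (le := (· ≥ ·)) (fun a b _ _ h1 h2 => le_antisymm h2 h1)
    p.2.1 q.2.1 ?_
  rw [List.perm_iff_count]
  intro x
  by_cases hx : 0 < x ∧ x ≤ k
  · have := DFunLike.congr_fun hpq (⟨x - 1, by omega⟩ : Fin k)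
    simp only [expo_apply] at this
    rwa [show x - 1 + 1 = x by omega] at this
  · rw [List.count_eq_zero.2 fun h => hx (p.2.2 x h), List.count_eq_zero.2 fun h => hx (q.2.2 x h)]

theorem expo_surjective {k : ℕ} :
    Function.Surjective fun p : BoundedPartition k => expo k p.1 := by
  intro a
  let s : Multiset ℕ := ∑ i : Fin k, Multiset.replicate (a i) ((i : ℕ) + 1)
  refine ⟨⟨s.sort (· ≥ ·), Multiset.pairwise_sort _ _, fun x hx => ?_⟩, ?_⟩
  · rw [Multiset.mem_sort, Multiset.mem_sum] at hx
    obtain ⟨i, -, hi⟩ := hx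
    rw [Multiset.eq_of_mem_replicate hi]
    exact ⟨by omega, i.2⟩
  · ext i
    change expo k (s.sort (· ≥ ·)) i = a i
    rw [expo_apply, ← Multiset.coe_count, Multiset.sort_eq, Multiset.count_sum',
      Finset.sum_eq_single i]
    · rw [Multiset.count_replicate_self]
    · intro j _ hj
      rw [Multiset.count_replicate, if_neg]
      intro e
      exact hj (Fin.ext (by omega))
    · exact fun h => absurd (Finset.mem_univ i) h

/-- Bounded partitions correspond to exponent vectors. -/
def expEquiv (k : ℕ) : BoundedPartition k ≃ (Fin k →₀ ℕ) :=
  Equiv.ofBijective _ ⟨expo_injective, expo_surjective⟩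

theorem expEquiv_apply {k : ℕ} (p : BoundedPartition k) : expEquiv k p = expo k p.1 := rfl

theorem lead_prod_schur {k : ℕ} (l : List (List ℕ))
    (hl : ∀ q ∈ l, q.Pairwise (· ≥ ·) ∧ mainHook q ≤ k)
    (hm : (l.map schur).prod ∈ ringK k) :
    Lead (⟨(l.map schur).prod, hm⟩ : ringK k) (expo k l.flatten) := by
  induction l with
  | nil => exact lead_one k
  | cons q l ih =>
    have hq := hl q List.mem_cons_self
    have hl' := fun x hx => hl x (List.mem_cons_of_mem q hx)
    have hm' : (l.map schur).prod ∈ ringK k := by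
      refine list_prod_mem fun x hx => ?_
      obtain ⟨y, hy, rfl⟩ := List.mem_map.1 hx
      exact schur_mem (hl' y hy).1 (hl' y hy).2
    rw [List.flatten_cons, expo_append]
    have := (lead_schurK hq.1 hq.2).mul (ih hl' hm')
    convert this using 1
    apply Subtype.ext
    simp [schurK]

theorem flatten_kSplit (k : ℕ) (l : List ℕ) : (kSplit k l).flatten = l := by
  fun_induction kSplit k l with
  | case1 => rfl
  | case2 a l ih => rw [List.flatten_cons, ih, List.cons_append, List.take_append_drop]

theorem lead_splitPoly {k : ℕ} (p : BoundedPartition k) :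
    Lead (splitPoly k p) (expo k p.1) := by
  have := lead_prod_schur (k := k) (kSplit k p.1)
    (kSplit_spec k p.1 p.2.1 fun x hx => (p.2.2 x hx).2) (splitPoly k p).2
  rwa [flatten_kSplit] at this

/-- The monomial basis of `Λ^(k)`, indexed by bounded partitions. -/
def monBP (k : ℕ) : Module.Basis (BoundedPartition k) ℚ (ringK k) :=
  (mon k).reindex (expEquiv k).symm

theorem monBP_apply {k : ℕ} (p : BoundedPartition k) : monBP k p = mon k (expo k p.1) := by
  simp [monBP, expEquiv_apply]

theorem image_monBP (k n : ℕ) :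
    Submodule.span ℚ (monBP k '' {p | wt (expo k p.1) < n}) = low k n := by
  rw [low]
  congr 1
  ext x
  constructor
  · rintro ⟨p, hp, rfl⟩
    exact ⟨_, hp, (monBP_apply p).symm⟩
  · rintro ⟨a, ha, rfl⟩
    obtain ⟨p, rfl⟩ := expo_surjective a
    exact ⟨p, ha, monBP_apply p⟩

theorem splitPoly_triangular {k : ℕ} (p : BoundedPartition k) :
    splitPoly k p - monBP k p ∈
      Submodule.span ℚ (monBP k '' {q | wt (expo k q.1) < wt (expo k p.1)}) := by
  rw [image_monBP, monBP_apply]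
  exact lead_splitPoly p

/-- This settles the case distinction in `proj`, so the projections act as intended. -/
theorem splitPoly_basis (k : ℕ) :
    LinearIndependent ℚ (splitPoly k) ∧ ⊤ ≤ Submodule.span ℚ (Set.range (splitPoly k)) :=
  ⟨linearIndependent_of_triangular (monBP k) _ _ splitPoly_triangular,
    top_le_span_of_triangular (monBP k) _ _ splitPoly_triangular⟩

open Classical in
theorem proj_splitPoly {k : ℕ} (j : ℕ) (p : BoundedPartition k) :
    proj k j (splitPoly k p) = if p.first = j then splitPoly k p else 0 := by
  rw [proj, dif_pos (splitPoly_basis k)]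
  conv_lhs => rw [← Module.Basis.mk_apply (splitPoly_basis k).1 (splitPoly_basis k).2 p]
  rw [Module.Basis.constr_basis]

/-- By triangularity each step of the filtration is also spanned by split polynomials, and the
projection fixes or kills each of these. -/
theorem proj_mem_low {k n : ℕ} (j : ℕ) {x : ringK k} (hx : x ∈ low k n) :
    proj k j x ∈ low k n := by
  rw [← image_monBP] at hx
  have hx' := span_lt_eq_of_triangular _ _ _ splitPoly_triangular n hx
  clear hx
  induction hx' using Submodule.span_induction with
  | mem x hx =>
    obtain ⟨p, hp, rfl⟩ := hx
    rw [proj_splitPoly]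
    split_ifs
    · have h1 := add_mem (low_mono (le_of_lt hp) (lead_splitPoly p)) (mon_mem_low hp)
      rwa [sub_add_cancel] at h1
    · exact zero_mem _
  | zero => rw [map_zero]; exact zero_mem _
  | add x y _ _ ihx ihy => rw [map_add]; exact add_mem ihx ihy
  | smul c x _ ih => rw [map_smul]; exact Submodule.smul_mem _ _ ih

/-- Modulo lower weight `f` equals the split polynomial of `p`, which the projection fixes. -/
theorem lead_proj {k : ℕ} (p : BoundedPartition k) {f : ringK k} (hf : Lead f (expo k p.1)) :
    Lead (proj k p.first f) (expo k p.1) := by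
  have h1 : f - splitPoly k p ∈ low k (wt (expo k p.1)) := by
    have := sub_mem hf (lead_splitPoly p)
    rwa [sub_sub_sub_cancel_right] at this
  have h2 := proj_mem_low p.first h1
  rw [map_sub, proj_splitPoly, if_pos rfl] at h2
  have := add_mem h2 (lead_splitPoly p)
  rwa [sub_add_sub_cancel] at this

theorem lead_kSchur {k : ℕ} (p : BoundedPartition k) : Lead (kSchur p) (expo k p.1) := by
  obtain ⟨l, hl⟩ := p
  induction l with
  | nil => exact lead_one k
  | cons a l ih =>
    have hl' : l.Pairwise (· ≥ ·) ∧ ∀ x ∈ l, 0 < x ∧ x ≤ k :=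
      ⟨(List.pairwise_cons.1 hl.1).2, fun x hx => hl.2 x (List.mem_cons_of_mem a hx)⟩
    refine lead_proj (⟨a :: l, hl⟩ : BoundedPartition k) ?_
    have h1 := lead_schurK (k := k) (List.pairwise_singleton _ a)
      (show mainHook [a] ≤ k by simpa [mainHook] using (hl.2 a List.mem_cons_self).2)
    have h2 := h1.mul (ih hl')
    rwa [expo_cons, expo_nil, add_zero, ← expo_cons] at h2

/-! ### Rectangles and the basis adapted to the ideal -/

/-- The index of the rectangle with parts `i + 1`. -/
def rectIdx {k : ℕ} (i : Fin k) : Set.Icc 1 k := ⟨i + 1, by omega, i.2⟩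

theorem lead_rectSchur {k : ℕ} (i : Fin k) :
    Lead (rectSchur k (rectIdx i)) (Finsupp.single i (k - i)) := by
  have h : expo k (List.replicate (k + 1 - (i + 1)) (i + 1)) = Finsupp.single i (k - i) := by
    rw [expo, List.map_replicate, List.sum_replicate, part_succ, Finsupp.smul_single, smul_eq_mul,
      mul_one, Nat.add_sub_add_right]
  rw [← h]
  exact lead_schurK _ _

/-- The remainder of an exponent vector after removing as many rectangles as possible. -/
def residue {k : ℕ} (a : Fin k →₀ ℕ) : Fin k →₀ ℕ :=
  Finsupp.equivFunOnFinite.symm fun i => a i % (k - i)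

theorem residue_apply {k : ℕ} (a : Fin k →₀ ℕ) (i : Fin k) : residue a i = a i % (k - i) := rfl

/-- The product of the rectangles contained in `a` and the `k`-Schur function of the remainder. -/
def rectProd {k : ℕ} (a : Fin k →₀ ℕ) : ringK k :=
  (∏ i, rectSchur k (rectIdx i) ^ (a i / (k - i))) * kSchur ((expEquiv k).symm (residue a))

theorem lead_rectProd {k : ℕ} (a : Fin k →₀ ℕ) : Lead (rectProd a) a := by
  have h1 := lead_kSchur ((expEquiv k).symm (residue a))
  rw [← expEquiv_apply, Equiv.apply_symm_apply] at h1
  have h2 := (lead_prod Finset.univ fun i => (lead_rectSchur i).pow (a i / (k - i))).mul h1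
  suffices he : ∑ i, (a i / (k - i)) • Finsupp.single i (k - (i : ℕ)) + residue a = a by
    rwa [he] at h2
  ext i
  rw [Finsupp.add_apply, Finsupp.finsetSum_apply, Finset.sum_eq_single i, Finsupp.smul_apply,
    Finsupp.single_eq_same, residue_apply, smul_eq_mul, mul_comm, Nat.div_add_mod]
  · intro j _ hj
    rw [Finsupp.smul_apply, Finsupp.single_eq_of_ne (Ne.symm hj), smul_zero]
  · exact fun h => absurd (Finset.mem_univ i) h

theorem linearIndependent_rectProd (k : ℕ) :
    LinearIndependent ℚ (rectProd : (Fin k →₀ ℕ) → ringK k) :=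
  linearIndependent_of_triangular (mon k) rectProd wt lead_rectProd

theorem top_le_span_rectProd (k : ℕ) :
    ⊤ ≤ Submodule.span ℚ (Set.range (rectProd : (Fin k →₀ ℕ) → ringK k)) :=
  top_le_span_of_triangular (mon k) rectProd wt lead_rectProd

/-- Adding a full rectangle leaves the remainder unchanged and raises one quotient by one. -/
theorem rectSchur_mul_rectProd {k : ℕ} (i : Fin k) (a : Fin k →₀ ℕ) :
    rectSchur k (rectIdx i) * rectProd a = rectProd (a + Finsupp.single i (k - i)) := by
  have hpos : 0 < k - (i : ℕ) := by have := i.2; omega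
  have hres : residue (a + Finsupp.single i (k - i)) = residue a := by
    ext j
    rw [residue_apply, residue_apply, Finsupp.add_apply]
    by_cases hj : j = i
    · rw [hj, Finsupp.single_eq_same, Nat.add_mod_right]
    · rw [Finsupp.single_eq_of_ne hj, add_zero]
  rw [rectProd, rectProd, hres, ← mul_assoc]
  congr 1
  rw [← Finset.mul_prod_erase _ _ (Finset.mem_univ i), ← mul_assoc, ← pow_succ',
    ← Finset.mul_prod_erase _ _ (Finset.mem_univ i)]
  congr 1
  · rw [Finsupp.add_apply, Finsupp.single_eq_same, Nat.add_div_right _ hpos]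
  · refine Finset.prod_congr rfl fun j hj => ?_
    rw [Finsupp.add_apply, Finsupp.single_eq_of_ne (Finset.mem_erase.1 hj).1, add_zero]

/-- The exponent vectors that contain a rectangle. -/
def reducible (k : ℕ) : Set (Fin k →₀ ℕ) := {a | ∃ i : Fin k, k - i ≤ a i}

theorem rectSchur_mul_mem {k : ℕ} (i : Fin k) (x : ringK k) :
    rectSchur k (rectIdx i) * x ∈ Submodule.span ℚ (rectProd '' reducible k) := by
  have hx := top_le_span_rectProd k (Submodule.mem_top (x := x))
  induction hx using Submodule.span_induction with
  | mem x hx =>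
    obtain ⟨a, rfl⟩ := hx
    rw [rectSchur_mul_rectProd]
    exact Submodule.subset_span ⟨_, ⟨i, by simp⟩, rfl⟩
  | zero => rw [mul_zero]; exact zero_mem _
  | add x y _ _ ihx ihy => rw [mul_add]; exact add_mem ihx ihy
  | smul c x _ ih => rw [mul_smul_comm]; exact Submodule.smul_mem _ _ ih

theorem rectProd_mem_rectIdeal {k : ℕ} {a : Fin k →₀ ℕ} (ha : a ∈ reducible k) :
    rectProd a ∈ rectIdeal k := by
  obtain ⟨i, hi⟩ := ha
  have hle : Finsupp.single i (k - (i : ℕ)) ≤ a := Finsupp.single_le_iff.2 hi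
  rw [← tsub_add_cancel_of_le hle, ← rectSchur_mul_rectProd]
  exact Ideal.mul_mem_right _ _ (Ideal.subset_span ⟨_, rfl⟩)

/-- Together with `rectProd_mem_rectIdeal` this identifies the ideal with the span of a subset of a
basis. -/
theorem mem_span_of_mem_rectIdeal {k : ℕ} {x : ringK k} (hx : x ∈ rectIdeal k) :
    x ∈ Submodule.span ℚ (rectProd '' reducible k) := by
  obtain ⟨c, rfl⟩ := Ideal.mem_span_range_iff_exists_fun.1 hx
  refine sum_mem fun l _ => ?_
  have hl : l = rectIdx (⟨l - 1, by have := l.2.1; have := l.2.2; omega⟩ : Fin k) :=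
    Subtype.ext (by have := l.2.1; simp only [rectIdx]; omega)
  rw [mul_comm, hl]
  exact rectSchur_mul_mem _ _

/-! ### Irreducible partitions and the quotient ring -/

theorem irreducible_iff {k : ℕ} (p : BoundedPartition k) :
    p.Irreducible ↔ ∀ i : Fin k, expEquiv k p i < k - i := by
  simp only [expEquiv_apply, expo_apply]
  constructor
  · intro h i
    -- The part size $i+1$ is $k-j$ for $j=k-(i+1)$, and at most $j$ copies means fewer than $k-i$.
    have h1 := h (k - (i + 1)) (by omega)
    rw [show k - (k - ((i : ℕ) + 1)) = i + 1 by omega] at h1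
    omega
  · intro h j hj
    have h1 := h ⟨k - (j + 1), by omega⟩
    dsimp only at h1
    rw [show k - (j + 1) + 1 = k - j by omega] at h1
    omega

theorem rectProd_of_irreducible {k : ℕ} {p : BoundedPartition k} (hp : p.Irreducible) :
    rectProd (expEquiv k p) = kSchur p := by
  rw [irreducible_iff] at hp
  have hres : residue (expEquiv k p) = expEquiv k p := by
    ext i
    rw [residue_apply, Nat.mod_eq_of_lt (hp i)]
  rw [rectProd, hres, Equiv.symm_apply_apply,
    Finset.prod_eq_one fun i _ => by rw [Nat.div_eq_of_lt (hp i), pow_zero], one_mul]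

theorem linearIndependent_mk_kSchur (k : ℕ) :
    LinearIndependent ℚ fun p : {p : BoundedPartition k // p.Irreducible} =>
      Ideal.Quotient.mk (rectIdeal k) (kSchur p.1) := by
  have hli : LinearIndependent ℚ fun p : {p : BoundedPartition k // p.Irreducible} =>
      kSchur p.1 := by
    have := (linearIndependent_rectProd k).comp
      (fun p : {p : BoundedPartition k // p.Irreducible} => expEquiv k p.1)
      ((expEquiv k).injective.comp Subtype.val_injective)
    convert this using 1
    funext p
    exact (rectProd_of_irreducible p.2).symm
  refine hli.map (f := (Ideal.Quotient.mkₐ ℚ (rectIdeal k)).toLinearMap) ?_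
  -- Disjoint subsets of an independent family span subspaces meeting only in zero: irreducible
  -- $k$-Schur functions on one side, the kernel of the quotient map on the other.
  have hdis := (linearIndependent_rectProd k).disjoint_span_image
    (disjoint_compl_left (a := reducible k))
  refine hdis.mono (Submodule.span_mono ?_) ?_
  · rintro _ ⟨p, rfl⟩
    refine ⟨expEquiv k p.1, ?_, rectProd_of_irreducible p.2⟩
    rintro ⟨i, hi⟩
    exact absurd ((irreducible_iff p.1).1 p.2 i) (not_lt.2 hi)
  · intro x hx
    exact mem_span_of_mem_rectIdeal (Ideal.Quotient.eq_zero_iff_mem.1 hx)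

theorem top_le_span_mk_kSchur (k : ℕ) :
    ⊤ ≤ Submodule.span ℚ (Set.range fun p : {p : BoundedPartition k // p.Irreducible} =>
      Ideal.Quotient.mk (rectIdeal k) (kSchur p.1)) := by
  rintro y -
  obtain ⟨x, rfl⟩ := Ideal.Quotient.mk_surjective y
  have hx := top_le_span_rectProd k (Submodule.mem_top (x := x))
  induction hx using Submodule.span_induction with
  | mem x hx =>
    obtain ⟨a, rfl⟩ := hx
    by_cases ha : a ∈ reducible k
    · rw [Ideal.Quotient.eq_zero_iff_mem.2 (rectProd_mem_rectIdeal ha)]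
      exact zero_mem _
    · obtain ⟨p, rfl⟩ := (expEquiv k).surjective a
      have hp : p.Irreducible :=
        (irreducible_iff p).2 fun i => not_le.1 fun hi => ha ⟨i, hi⟩
      rw [rectProd_of_irreducible hp]
      exact Submodule.subset_span ⟨⟨p, hp⟩, rfl⟩
  | zero => rw [map_zero]; exact zero_mem _
  | add x y _ _ ihx ihy => rw [map_add]; exact add_mem ihx ihy
  | smul c x _ ih => exact Submodule.smul_mem _ c ih

/-- The multiplicities of the parts are chosen independently, with $k-i$ choices for the part $i+1$,
and the product of these is $k!$. -/
theorem card_irreducible (k : ℕ) :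
    Nat.card {p : BoundedPartition k // p.Irreducible} = k.factorial := by
  have e : {p : BoundedPartition k // p.Irreducible} ≃ ((i : Fin k) → {n : ℕ // n < k - i}) :=
    (((expEquiv k).trans Finsupp.equivFunOnFinite).subtypeEquiv fun p => irreducible_iff p).trans
      (Equiv.subtypePiEquivPi (p := fun (i : Fin k) (n : ℕ) => n < k - i))
  rw [Nat.card_congr e, Nat.card_pi, ← Nat.descFactorial_self, Nat.descFactorial_eq_prod_range,
    ← Fin.prod_univ_eq_prod_range (fun i => k - i)]
  refine Finset.prod_congr rfl fun i _ => ?_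
  rw [Nat.card_congr (Fin.equivSubtype (n := k - i)).symm, Nat.card_fin]

end KSchur

end

theorem mainTheorem11 (k : ℕ) (hk : 1 ≤ k) :
    (∃ b : Module.Basis {p : KSchur.BoundedPartition k // p.Irreducible} ℚ
        (KSchur.ringK k ⧸ KSchur.rectIdeal k),
      ∀ p, b p = Ideal.Quotient.mk (KSchur.rectIdeal k) (KSchur.kSchur p.1)) ∧
    Module.finrank ℚ (KSchur.ringK k ⧸ KSchur.rectIdeal k) = Nat.factorial k := by
  let b := Module.Basis.mk (KSchur.linearIndependent_mk_kSchur k) (KSchur.top_le_span_mk_kSchur k)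
  refine ⟨⟨b, fun p => Module.Basis.mk_apply _ _ p⟩, ?_⟩
  rw [Module.finrank_eq_nat_card_basis b, KSchur.card_irreducible]
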